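/- A linear metro line with two terminus stations is a closed path of $n$ segments and $n$ nodes, indexed cyclically modulo $n$; segment $j$ leads from node $j-1$ to node $j$. Let $b_j\in\{0,1\}$ be the number of trains on segment $j$ at time zero, $\bar b_j=1-b_j$, and let $m=\sum_j b_j$ be the number of trains; assume $0<m<n$. Let $\lambda_{ij}\ge 0$ be the average passenger flow from $i$ to $j$, let $\alpha^{in}_j,\alpha^{out}_j>0$ be the average boarding and alighting rates, and put $$x_j=\frac{\sum_i\lambda_{ij}}{\alpha_j^{out}}+\frac{\sum_i\lambda_{ji}}{\alpha_j^{in}},\qquad X_j=\frac{x_j}{1-x_j},$$ where $x_j<1$ for all $j$ is assumed. Let $\underline g_j,\bar g_j$ be the minimum and maximum dynamic intervals, $\underline r_j,\tilde r_j$ the minimum and nominal run times, and $s_j$ the minimum safe separation times (real numbers). Put $\underline h_j=\underline g_j/(1-x_j)$, $\bar h_j=\bar g_j/(1-x_j)$, $\underline w_j=x_j\underline h_j$, $\bar w_j=x_j\bar h_j$, $\Delta w_j=\bar w_j-\underline w_j$, $\Delta r_j=\tilde r_j-\underline r_j$, and define $$h(m,X)=\max\Big\{\frac{\sum_j(\underline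 g_jX_j+\tilde r_j)}{m},\ \max_j(\underline g_jX_j+\tilde r_j+s_j),\ \frac{\sum_j s_j}{n-m}\Big\}.$$ Let $d^k_j$, $k\ge 0$, be the $k$-th departure time from node $j$, where $d^0$ is the initial state, and let $h^k_j=d^k_j-d^{k-1}_j$, $k\ge1$, be the headways. (a) If $d$ satisfies the max-plus linear dynamics $$d^k_j=\max\{d^{k-b_j}_{j-1}+\tilde r_j+X_j\underline g_j,\ d^{k-\bar b_{j+1}}_{j+1}+s_{j+1}\}\qquad(k\ge 1,\ \text{all } j),$$ then for every $j$ the asymptotic average growth rate $\lim_k d^k_j/k$ and the asymptotic average headway $\lim_K \frac1K\sum_{k=1}^K h^k_j$ exist and are equal to $h(m,X)$. (b) The same conclusion holds if $d$ satisfies the dynamics with demand-dependent dwell times and controlled run times $$d^k_j=\max\{d^{k-b_j}_{j-1}+t_j(h^k_j),\ d^{k-\bar b_{j+1}}_{j+1}+s_{j+1}\}\qquad(k\ge 1,\ \text{all } j),$$ $$t_j(h)=\max\{\underline r_j,\ \underline r_j+\Delta r_j-x_j(h-\underline h_j)\}+\min\{x_jh,\ \bar w_j\},$$ provided that $h^1_j\le\bar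 h_j$ and $\Delta r_j\ge\Delta w_j$ for all $j$ and that, for each $j$ with $x_j>0$ and $\Delta r_j>\Delta w_j$, one has $h^1_i\le\bar h_j$ for all $i$. -/

import Mathlib

open Filter Topology

/-- Data of a linear metro line with `n` segments. The two directions between the terminus
stations form one closed path, so nodes and segments are indexed cyclically; segment `j` goes from
node `j - 1` to node `j`. -/
structure LinearLine (n : ℕ) where
  /-- number of trains on segment `j` at time zero -/
  b : ZMod n → ℕ
  b_le_one : ∀ j, b j ≤ 1
  /-- average passenger flow from platform `i` to platform `j`
  (zero if one of them is not a platform) -/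
  lam : ZMod n → ZMod n → ℝ
  lam_nonneg : ∀ i j, 0 ≤ lam i j
  /-- average boarding rate -/
  alphaIn : ZMod n → ℝ
  alphaIn_pos : ∀ j, 0 < alphaIn j
  /-- average alighting rate -/
  alphaOut : ZMod n → ℝ
  alphaOut_pos : ∀ j, 0 < alphaOut j
  /-- minimum dynamic interval -/
  gMin : ZMod n → ℝ
  /-- maximum dynamic interval -/
  gMax : ZMod n → ℝ
  /-- minimum run time -/
  rMin : ZMod n → ℝ
  /-- nominal run time -/
  rNom : ZMod n → ℝ
  /-- minimum safe separation time -/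
  s : ZMod n → ℝ

/-- The `k`-th departure headway at node `j` (used for `1 ≤ k` only). -/
def headway {n : ℕ} (d : ℕ → ZMod n → ℝ) (k : ℕ) (j : ZMod n) : ℝ :=
  d k j - d (k - 1) j

namespace LinearLine

variable {n : ℕ} [NeZero n] (L : LinearLine n)

/-- `1 - b j`. -/
def bBar (L : LinearLine n) (j : ZMod n) : ℕ := 1 - L.b j

/-- The number of trains on the line. -/
def trains : ℕ := ∑ j, L.b j

/-- Passenger arrival rate on origin platform `i`. -/
def lamIn (i : ZMod n) : ℝ := ∑ j, L.lam i j

/-- Passenger departure rate from destination platform `j`. -/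
def lamOut (j : ZMod n) : ℝ := ∑ i, L.lam i j

/-- The passenger demand parameter `x j`. -/
noncomputable def x (j : ZMod n) : ℝ :=
  L.lamOut j / L.alphaOut j + L.lamIn j / L.alphaIn j

/-- The passenger demand parameter `X j = x j / (1 - x j)`. -/
noncomputable def X (j : ZMod n) : ℝ := L.x j / (1 - L.x j)

/-- Minimum headway. -/
noncomputable def hMin (j : ZMod n) : ℝ := 1 / (1 - L.x j) * L.gMin j

/-- Maximum headway. -/
noncomputable def hMax (j : ZMod n) : ℝ := 1 / (1 - L.x j) * L.gMax j

/-- Minimum dwell time. -/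
noncomputable def wMin (j : ZMod n) : ℝ := L.x j * L.hMin j

/-- Maximum dwell time. -/
noncomputable def wMax (j : ZMod n) : ℝ := L.x j * L.hMax j

/-- Dwell time margin. -/
noncomputable def deltaW (j : ZMod n) : ℝ := L.wMax j - L.wMin j

/-- Run time margin. -/
def deltaR (L : LinearLine n) (j : ZMod n) : ℝ := L.rNom j - L.rMin j

/-- Dwell time law, as a function of the headway `h`. -/
noncomputable def dwellTime (j : ZMod n) (h : ℝ) : ℝ := min (L.x j * h) (L.wMax j)

/-- Run time law, as a function of the headway `h`. -/
noncomputable def runTime (j : ZMod n) (h : ℝ) : ℝ :=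
  max (L.rMin j) (L.rMin j + L.deltaR j - L.x j * (h - L.hMin j))

/-- Travel time law, as a function of the headway `h`. -/
noncomputable def travelTime (j : ZMod n) (h : ℝ) : ℝ := L.runTime j h + L.dwellTime j h

/-- `d k j` is the `k`-th departure time from node `j`, and `d 0` is the initial state. A train
departs as soon as both the demand-dependent travel time constraint and the safe separation
constraint are satisfied. The travel time depends on the headway that ends with the departure
itself. -/
def IsDemandDependentTrajectory (d : ℕ → ZMod n → ℝ) : Prop :=
  ∀ k : ℕ, 1 ≤ k → ∀ j : ZMod n,
    d k j = max
      (d (k - L.b j) (j - 1) + L.travelTime j (headway d k j))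
      (d (k - L.bBar (j + 1)) (j + 1) + L.s (j + 1))

/-- The max-plus linear train dynamics, with travel times `rNom j + X j * gMin j`. -/
def IsMaxPlusTrajectory (d : ℕ → ZMod n → ℝ) : Prop :=
  ∀ k : ℕ, 1 ≤ k → ∀ j : ZMod n,
    d k j = max
      (d (k - L.b j) (j - 1) + (L.rNom j + L.X j * L.gMin j))
      (d (k - L.bBar (j + 1)) (j + 1) + L.s (j + 1))

/-- `max {∑ (gMin X + rNom) / m, max (gMin X + rNom + s), ∑ s / (n - m)}`. -/
noncomputable def headwayFormula : ℝ :=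
  max ((∑ j, (L.gMin j * L.X j + L.rNom j)) / (L.trains : ℝ))
    (max (Finset.univ.sup' Finset.univ_nonempty
        (fun j : ZMod n => L.gMin j * L.X j + L.rNom j + L.s j))
      ((∑ j, L.s j) / ((n : ℝ) - (L.trains : ℝ))))

end LinearLine

/-- Every component of `d k` has asymptotic average growth rate `h`. -/
def HasAverageGrowthRate {n : ℕ} (d : ℕ → ZMod n → ℝ) (h : ℝ) : Prop :=
  ∀ j, Tendsto (fun k : ℕ => d k j / (k : ℝ)) atTop (𝓝 h)

/-- At every node the average of the first `K` headways tends to `h`. -/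
def HasAverageHeadway {n : ℕ} (d : ℕ → ZMod n → ℝ) (h : ℝ) : Prop :=
  ∀ j, Tendsto (fun K : ℕ => (∑ k ∈ Finset.Icc 1 K, headway d k j) / (K : ℝ)) atTop (𝓝 h)

/-! With `h = L.headwayFormula`, a max-plus trajectory stays within bounded distance of `h * k`,
which gives both limits, headways telescoping. The upper bound `h * k + v j + C` needs a potential
satisfying every constraint, and each of the three terms of the maximum is what its existence
requires (`exists_upper_potential`). The lower bound needs one constraint per node, supplied by a
circuit attaining the maximum (`exists_lower_potential`). Both bounds propagate by
`dynamics_induction`. In the demand-dependent case, run time control absorbs dwell variation while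
headways stay below saturation, and the dynamics preserve that bound; the trajectory is then
max-plus. -/

/-! ### Potentials on the cycle and averages -/

theorem ZMod.sum_eq_sum_range {n : ℕ} [NeZero n] (u : ZMod n → ℝ) :
    ∑ j, u j = ∑ i ∈ Finset.range n, u (i : ZMod n) := by
  refine (Finset.sum_bij (fun (i : ℕ) _ => (i : ZMod n)) ?_ ?_ ?_ ?_).symm
  · intro i _
    exact Finset.mem_univ _
  · intro a ha b hb hab
    have h := congrArg ZMod.val hab
    rwa [ZMod.val_natCast_of_lt (Finset.mem_range.1 ha),
      ZMod.val_natCast_of_lt (Finset.mem_range.1 hb)] at h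
  · intro j _
    exact ⟨j.val, Finset.mem_range.2 (ZMod.val_lt j), ZMod.natCast_zmod_val j⟩
  · intro i _
    rfl

/-- A function on the cycle with vanishing sum is the increment of a potential. -/
theorem exists_cyclic_potential {n : ℕ} [NeZero n] (u : ZMod n → ℝ) (hu : ∑ j, u j = 0) :
    ∃ v : ZMod n → ℝ, ∀ j, v j = v (j - 1) + u j := by
  let S : ℕ → ℝ := fun k => ∑ i ∈ Finset.range k, u (i : ZMod n)
  have hS : ∀ k, S (k + 1) = S k + u (k : ZMod n) := fun k => Finset.sum_range_succ _ _
  have hper : Function.Periodic S n := by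
    intro k
    induction k with
    | zero =>
      rw [ZMod.sum_eq_sum_range] at hu
      simp [S, hu]
    | succ k ih =>
      rw [show k + 1 + n = k + n + 1 by ring, hS, hS, ih]
      simp
  refine ⟨fun j => S (j.val + 1), fun j => ?_⟩
  -- Only modulo `n`: at `j = 0` the representative wraps around, and periodicity of `S` absorbs
  -- this.
  have h : ((j - 1).val + 1) % n = j.val % n := by
    have : (((j - 1).val + 1 : ℕ) : ZMod n) = (j.val : ZMod n) := by simp
    exact (ZMod.natCast_eq_natCast_iff _ _ _).1 this
  have h' : S ((j - 1).val + 1) = S j.val := by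
    rw [← hper.map_mod_nat, h, hper.map_mod_nat]
  change S (j.val + 1) = S ((j - 1).val + 1) + u j
  rw [h', hS, ZMod.natCast_zmod_val]

theorem exists_between_sum_eq_zero {ι : Type*} [Fintype ι] (a c : ι → ℝ) (hac : ∀ j, a j ≤ c j)
    (ha : ∑ j, a j ≤ 0) (hc : 0 ≤ ∑ j, c j) :
    ∃ u : ι → ℝ, (∀ j, a j ≤ u j) ∧ (∀ j, u j ≤ c j) ∧ ∑ j, u j = 0 := by
  rcases ha.eq_or_lt with ha | ha
  · exact ⟨a, fun _ => le_rfl, hac, ha⟩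
  have hpos : 0 < ∑ j, c j - ∑ j, a j := by linarith
  set θ : ℝ := -(∑ j, a j) / (∑ j, c j - ∑ j, a j) with hθ
  have h0 : 0 ≤ θ := div_nonneg (by linarith) hpos.le
  have h1 : θ ≤ 1 := (div_le_one hpos).2 (by linarith)
  refine ⟨fun j => a j + θ * (c j - a j), fun j => ?_, fun j => ?_, ?_⟩
  · have := mul_nonneg h0 (sub_nonneg.2 (hac j))
    linarith
  · have := mul_le_of_le_one_left (sub_nonneg.2 (hac j)) h1
    linarith
  · rw [Finset.sum_add_distrib, ← Finset.mul_sum, Finset.sum_sub_distrib, hθ,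
      div_mul_cancel₀ _ hpos.ne']
    ring

theorem tendsto_div_of_abs_sub_mul_le {f : ℕ → ℝ} {h C : ℝ} (hf : ∀ k, |f k - h * k| ≤ C) :
    Tendsto (fun k : ℕ => f k / (k : ℝ)) atTop (𝓝 h) := by
  have hC : Tendsto (fun k : ℕ => C / (k : ℝ)) atTop (𝓝 0) :=
    tendsto_const_div_atTop_nhds_zero_nat C
  rw [tendsto_iff_norm_sub_tendsto_zero]
  refine squeeze_zero' (Eventually.of_forall fun _ => norm_nonneg _) ?_ hC
  filter_upwards [eventually_gt_atTop 0] with k hk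
  have hk' : (0 : ℝ) < k := Nat.cast_pos.2 hk
  rw [show f k / (k : ℝ) - h = (f k - h * k) / k by field_simp, Real.norm_eq_abs, abs_div,
    abs_of_pos hk']
  exact div_le_div_of_nonneg_right (hf k) hk'.le

theorem HasAverageGrowthRate.hasAverageHeadway {n : ℕ} {d : ℕ → ZMod n → ℝ} {h : ℝ}
    (hd : HasAverageGrowthRate d h) : HasAverageHeadway d h := by
  intro j
  have hsum : ∀ K : ℕ, ∑ k ∈ Finset.Icc 1 K, headway d k j = d K j - d 0 j := by
    intro K
    induction K with
    | zero => simp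
    | succ K ih =>
      rw [Finset.sum_Icc_succ_top (by omega), ih, headway, Nat.add_sub_cancel]
      ring
  have h0 : Tendsto (fun K : ℕ => d 0 j / (K : ℝ)) atTop (𝓝 0) :=
    tendsto_const_div_atTop_nhds_zero_nat _
  simpa [hsum, sub_div] using (hd j).sub h0

/-! ### Induction along the dependencies -/

namespace LinearLine

theorem bBar_le_one {n : ℕ} (L : LinearLine n) (j : ZMod n) : L.bBar j ≤ 1 := Nat.sub_le _ _

theorem cast_bBar {n : ℕ} (L : LinearLine n) (j : ZMod n) : (L.bBar j : ℝ) = 1 - L.b j := by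
  rw [bBar, Nat.cast_sub (L.b_le_one j), Nat.cast_one]

variable {n : ℕ} [NeZero n] (L : LinearLine n)

theorem sum_b : ∑ j, (L.b j : ℝ) = L.trains := by
  rw [trains, Nat.cast_sum]

/-- Induction along the dependencies of the train dynamics, which are well founded because the line
is neither empty nor full. -/
theorem dynamics_induction (hm_pos : 0 < L.trains) (hm_lt : L.trains < n)
    {P : ℕ → ZMod n → Prop} (h0 : ∀ j, P 0 j)
    (step : ∀ k, 1 ≤ k → ∀ j, P (k - L.b j) (j - 1) → P (k - L.bBar (j + 1)) (j + 1) → P k j) :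
    ∀ k j, P k j := by
  -- With this `p`, the rank `n * k + p j` drops by `m` along a travel dependency and by `n - m`
  -- along a separation dependency, so by at least 1.
  obtain ⟨p, hp⟩ := exists_cyclic_potential (fun j => (L.trains : ℝ) - n * L.b j) (by
    rw [Finset.sum_sub_distrib, ← Finset.mul_sum, L.sum_b]
    simp)
  obtain ⟨C, hC⟩ := (Set.finite_range p).bddBelow
  have hm : (1 : ℝ) ≤ L.trains := by exact_mod_cast hm_pos
  have hnm : (L.trains : ℝ) + 1 ≤ n := by exact_mod_cast hm_lt
  have key : ∀ (N : ℕ) (k : ℕ) (j : ZMod n), (n : ℝ) * k + p j < C + N → P k j := by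
    intro N
    induction N with
    | zero =>
      intro k j hkj
      have h1 : C ≤ p j := hC ⟨j, rfl⟩
      have h2 : (0 : ℝ) ≤ (n : ℝ) * k := by positivity
      simp only [Nat.cast_zero] at hkj
      linarith
    | succ N ih =>
      intro k j hkj
      rcases Nat.eq_zero_or_pos k with rfl | hk
      · exact h0 j
      push_cast at hkj
      refine step k hk j (ih _ _ ?_) (ih _ _ ?_)
      · rw [Nat.cast_sub ((L.b_le_one j).trans hk)]
        linarith [hp j]
      · rw [Nat.cast_sub ((L.bBar_le_one _).trans hk), cast_bBar]
        have := hp (j + 1)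
        rw [add_sub_cancel_right] at this
        linarith
  intro k j
  obtain ⟨N, hN⟩ := exists_nat_gt ((n : ℝ) * k + p j - C)
  exact key N k j (by linarith)

/-- The constant travel time of the max-plus linear dynamics. -/
noncomputable def nominalTime (j : ZMod n) : ℝ := L.rNom j + L.X j * L.gMin j

/-! ### Affine bounds on max-plus trajectories -/

variable {L} {d : ℕ → ZMod n → ℝ}

theorem IsMaxPlusTrajectory.exists_le (hd : L.IsMaxPlusTrajectory d)
    (hm_pos : 0 < L.trains) (hm_lt : L.trains < n) {h : ℝ} {v : ZMod n → ℝ}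
    (hfwd : ∀ j, v (j - 1) + L.nominalTime j - h * L.b j ≤ v j)
    (hbwd : ∀ j, v j + L.s j - h * (1 - L.b j) ≤ v (j - 1)) :
    ∃ C, ∀ k j, d k j ≤ h * k + v j + C := by
  obtain ⟨C, hC⟩ := (Set.finite_range fun j => d 0 j - v j).bddAbove
  refine ⟨C, L.dynamics_induction hm_pos hm_lt (fun j => ?_) fun k hk j h1 h2 => ?_⟩
  · have : d 0 j - v j ≤ C := hC ⟨j, rfl⟩
    simp only [Nat.cast_zero]
    linarith
  · rw [hd k hk j]
    rw [Nat.cast_sub ((L.b_le_one j).trans hk)] at h1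
    rw [Nat.cast_sub ((L.bBar_le_one _).trans hk), cast_bBar] at h2
    have hf := hfwd j
    have hb := hbwd (j + 1)
    rw [add_sub_cancel_right] at hb
    rw [nominalTime] at hf
    exact max_le (by linarith) (by linarith)

theorem IsMaxPlusTrajectory.exists_ge (hd : L.IsMaxPlusTrajectory d)
    (hm_pos : 0 < L.trains) (hm_lt : L.trains < n) {h : ℝ} {v : ZMod n → ℝ}
    (hv : ∀ j, v j ≤ v (j - 1) + L.nominalTime j - h * L.b j ∨
      v j ≤ v (j + 1) + L.s (j + 1) - h * (1 - L.b (j + 1))) :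
    ∃ C, ∀ k j, h * k + v j + C ≤ d k j := by
  obtain ⟨C, hC⟩ := (Set.finite_range fun j => d 0 j - v j).bddBelow
  refine ⟨C, L.dynamics_induction hm_pos hm_lt (fun j => ?_) fun k hk j h1 h2 => ?_⟩
  · have : C ≤ d 0 j - v j := hC ⟨j, rfl⟩
    simp only [Nat.cast_zero]
    linarith
  · rw [hd k hk j]
    rw [Nat.cast_sub ((L.b_le_one j).trans hk)] at h1
    rw [Nat.cast_sub ((L.bBar_le_one _).trans hk), cast_bBar] at h2
    rcases hv j with hv | hv
    · rw [nominalTime] at hv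
      exact le_max_of_le_left (by linarith)
    · exact le_max_of_le_right (by linarith)

/-! ### Potentials for the growth rate -/

variable (L)

theorem headwayFormula_eq : L.headwayFormula =
    max ((∑ j, L.nominalTime j) / (L.trains : ℝ))
      (max (Finset.univ.sup' Finset.univ_nonempty fun j : ZMod n => L.nominalTime j + L.s j)
        ((∑ j, L.s j) / ((n : ℝ) - (L.trains : ℝ)))) := by
  have h : ∀ j, L.gMin j * L.X j + L.rNom j = L.nominalTime j := fun j => by
    rw [nominalTime]; ring
  simp only [headwayFormula, h]

theorem exists_upper_potential (hm_pos : 0 < L.trains) (hm_lt : L.trains < n) :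
    ∃ v : ZMod n → ℝ, (∀ j, v (j - 1) + L.nominalTime j - L.headwayFormula * L.b j ≤ v j) ∧
      ∀ j, v j + L.s j - L.headwayFormula * (1 - L.b j) ≤ v (j - 1) := by
  have hm : (0 : ℝ) < L.trains := by exact_mod_cast hm_pos
  have hnm : (0 : ℝ) < (n : ℝ) - L.trains := sub_pos.2 (by exact_mod_cast hm_lt)
  have h1 : (∑ j, L.nominalTime j) / (L.trains : ℝ) ≤ L.headwayFormula := by
    rw [headwayFormula_eq]; exact le_max_left _ _
  have h2 : ∀ j, L.nominalTime j + L.s j ≤ L.headwayFormula := fun j => by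
    rw [headwayFormula_eq]
    exact le_max_of_le_right (le_max_of_le_left
      (Finset.le_sup' (fun j => L.nominalTime j + L.s j) (Finset.mem_univ j)))
  have h3 : (∑ j, L.s j) / ((n : ℝ) - (L.trains : ℝ)) ≤ L.headwayFormula := by
    rw [headwayFormula_eq]
    exact le_max_of_le_right (le_max_right _ _)
  generalize L.headwayFormula = h at h1 h2 h3 ⊢
  rw [div_le_iff₀ hm] at h1
  rw [div_le_iff₀ hnm] at h3
  -- The increment of `v` on each segment must lie in an interval: `h2` makes it nonempty, while
  -- `h1` and `h3` let the increments sum to zero.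
  obtain ⟨u, hau, huc, hu⟩ := exists_between_sum_eq_zero
    (fun j => L.nominalTime j - h * L.b j) (fun j => h * (1 - L.b j) - L.s j)
    (fun j => by linarith [h2 j])
    (by rw [Finset.sum_sub_distrib, ← Finset.mul_sum, L.sum_b]; linarith)
    (by
      rw [Finset.sum_sub_distrib, ← Finset.mul_sum, Finset.sum_sub_distrib, L.sum_b]
      simp only [Finset.sum_const, Finset.card_univ, ZMod.card, nsmul_eq_mul, mul_one]
      linarith)
  obtain ⟨v, hv⟩ := exists_cyclic_potential u hu
  exact ⟨v, fun j => by linarith [hv j, hau j], fun j => by linarith [hv j, huc j]⟩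

theorem exists_lower_potential (hm_pos : 0 < L.trains) (hm_lt : L.trains < n) :
    ∃ v : ZMod n → ℝ, ∀ j, v j ≤ v (j - 1) + L.nominalTime j - L.headwayFormula * L.b j ∨
      v j ≤ v (j + 1) + L.s (j + 1) - L.headwayFormula * (1 - L.b (j + 1)) := by
  have hm : (0 : ℝ) < L.trains := by exact_mod_cast hm_pos
  have hnm : (0 : ℝ) < (n : ℝ) - L.trains := sub_pos.2 (by exact_mod_cast hm_lt)
  have hcases : L.headwayFormula = (∑ j, L.nominalTime j) / (L.trains : ℝ) ∨
      (∃ i, L.headwayFormula = L.nominalTime i + L.s i) ∨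
      L.headwayFormula = (∑ j, L.s j) / ((n : ℝ) - (L.trains : ℝ)) := by
    rw [headwayFormula_eq]
    rcases max_choice ((∑ j, L.nominalTime j) / (L.trains : ℝ))
      (max (Finset.univ.sup' Finset.univ_nonempty fun j : ZMod n => L.nominalTime j + L.s j)
        ((∑ j, L.s j) / ((n : ℝ) - (L.trains : ℝ)))) with h | h
    · exact Or.inl h
    rw [h]
    rcases max_choice
      (Finset.univ.sup' Finset.univ_nonempty fun j : ZMod n => L.nominalTime j + L.s j)
      ((∑ j, L.s j) / ((n : ℝ) - (L.trains : ℝ))) with h | h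
    · obtain ⟨i, _, hi⟩ := Finset.exists_mem_eq_sup' (Finset.univ_nonempty (α := ZMod n))
        fun j => L.nominalTime j + L.s j
      exact Or.inr (Or.inl ⟨i, h.trans hi⟩)
    · exact Or.inr (Or.inr h)
  generalize L.headwayFormula = h at hcases ⊢
  rcases hcases with hh | ⟨i, hh⟩ | hh
  · rw [eq_div_iff hm.ne'] at hh
    obtain ⟨v, hv⟩ := exists_cyclic_potential (fun j => L.nominalTime j - h * L.b j)
      (by rw [Finset.sum_sub_distrib, ← Finset.mul_sum, L.sum_b]; linarith)
    exact ⟨v, fun j => Or.inl (by linarith [hv j])⟩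
  · let w : ZMod n → ℝ := fun j => L.nominalTime j - h * L.b j
    -- The critical circuit is `i - 1 → i → i - 1`. Every node but `i - 1` uses its travel
    -- constraint; node `i - 1` uses separation from `i`, so its increment is free to close the
    -- cycle.
    obtain ⟨v, hv⟩ := exists_cyclic_potential
      (fun j => w j - if j = i - 1 then ∑ j, w j else 0) (by
        rw [Finset.sum_sub_distrib, Finset.sum_ite_eq']
        simp)
    refine ⟨v, fun j => ?_⟩
    by_cases hj : j = i - 1
    · right
      have : Fact (1 < n) := ⟨by omega⟩
      have hne : i ≠ i - 1 := fun h => one_ne_zero (sub_eq_self.1 h.symm)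
      have := hv i
      rw [if_neg hne, sub_zero] at this
      simp only [w] at this
      rw [hj, sub_add_cancel]
      linarith
    · left
      have := hv j
      rw [if_neg hj, sub_zero] at this
      simp only [w] at this
      linarith
  · rw [eq_div_iff hnm.ne'] at hh
    obtain ⟨v, hv⟩ := exists_cyclic_potential (fun j => h * (1 - L.b j) - L.s j) (by
      rw [Finset.sum_sub_distrib, ← Finset.mul_sum, Finset.sum_sub_distrib, L.sum_b]
      simp only [Finset.sum_const, Finset.card_univ, ZMod.card, nsmul_eq_mul, mul_one]
      linarith)
    refine ⟨v, fun j => Or.inr ?_⟩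
    have := hv (j + 1)
    rw [add_sub_cancel_right] at this
    linarith

variable {L}

theorem IsMaxPlusTrajectory.hasAverageGrowthRate (hd : L.IsMaxPlusTrajectory d)
    (hm_pos : 0 < L.trains) (hm_lt : L.trains < n) :
    HasAverageGrowthRate d L.headwayFormula := by
  obtain ⟨v, hv1, hv2⟩ := L.exists_upper_potential hm_pos hm_lt
  obtain ⟨w, hw⟩ := L.exists_lower_potential hm_pos hm_lt
  obtain ⟨A, hA⟩ := hd.exists_le hm_pos hm_lt hv1 hv2
  obtain ⟨B, hB⟩ := hd.exists_ge hm_pos hm_lt hw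
  intro j
  refine tendsto_div_of_abs_sub_mul_le (C := max (v j + A) (-(w j + B))) fun k => ?_
  rw [abs_le']
  exact ⟨le_max_of_le_left (by linarith [hA k j]), le_max_of_le_right (by linarith [hB k j])⟩

/-! ### Reduction of the demand-dependent dynamics -/

variable (L)

theorem x_nonneg (j : ZMod n) : 0 ≤ L.x j :=
  add_nonneg
    (div_nonneg (Finset.sum_nonneg fun i _ => L.lam_nonneg i j) (L.alphaOut_pos j).le)
    (div_nonneg (Finset.sum_nonneg fun i _ => L.lam_nonneg j i) (L.alphaIn_pos j).le)

theorem nominalTime_eq (j : ZMod n) :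
    L.nominalTime j = L.rMin j + L.deltaR j + L.x j * L.hMin j := by
  rw [nominalTime, X, hMin, deltaR]
  ring

variable {L}

theorem travelTime_le_nominalTime {j : ZMod n} (hj : L.deltaW j ≤ L.deltaR j) (h : ℝ) :
    L.travelTime j h ≤ L.nominalTime j := by
  rw [nominalTime_eq, travelTime, runTime, dwellTime]
  rw [deltaW, wMin] at hj
  rcases max_choice (L.rMin j) (L.rMin j + L.deltaR j - L.x j * (h - L.hMin j)) with h1 | h1 <;>
    rw [h1]
  · linarith [min_le_right (L.x j * h) (L.wMax j)]
  · linarith [min_le_left (L.x j * h) (L.wMax j)]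

/-- Unsaturated dwell is compensated by the run time. Beyond `hMax`, equality survives if the
margins agree, since run time and dwell saturate together, or if `x j = 0`. -/
theorem travelTime_eq_nominalTime {j : ZMod n} {h : ℝ} (hj : L.deltaW j ≤ L.deltaR j)
    (hh : 0 < L.x j → L.deltaW j < L.deltaR j → h ≤ L.hMax j) :
    L.travelTime j h = L.nominalTime j := by
  refine le_antisymm (travelTime_le_nominalTime hj h) ?_
  rw [nominalTime_eq, travelTime, runTime, dwellTime]
  have h1 := le_max_left (L.rMin j) (L.rMin j + L.deltaR j - L.x j * (h - L.hMin j))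
  have h2 := le_max_right (L.rMin j) (L.rMin j + L.deltaR j - L.x j * (h - L.hMin j))
  rcases min_choice (L.x j * h) (L.wMax j) with h3 | h3
  · rw [h3]
    linarith
  rw [h3]
  rcases hj.eq_or_lt with heq | hlt
  · rw [deltaW, wMin] at heq
    linarith
  · have h4 : L.x j * h ≤ L.wMax j := by
      rcases (L.x_nonneg j).eq_or_lt with h0 | h0
      · rw [wMax, ← h0, zero_mul, zero_mul]
      · exact mul_le_mul_of_nonneg_left (hh h0 hlt) h0.le
    linarith

theorem IsDemandDependentTrajectory.isMaxPlusTrajectory (hd : L.IsDemandDependentTrajectory d)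
    (hm_pos : 0 < L.trains) (hm_lt : L.trains < n)
    (hW : ∀ j, L.deltaW j ≤ L.deltaR j)
    (hH : ∀ j, 0 < L.x j → L.deltaW j < L.deltaR j → ∀ i, headway d 1 i ≤ L.hMax j) :
    L.IsMaxPlusTrajectory d := by
  have key : ∀ (k : ℕ) (i : ZMod n), 1 ≤ k →
      ∀ j, 0 < L.x j → L.deltaW j < L.deltaR j → headway d k i ≤ L.hMax j := by
    -- All `l ≤ k` are bounded at once: a dependency with zero index shift then still covers the
    -- earlier headways, and an inner induction on `l` is available.
    suffices h : ∀ (k : ℕ) (i : ZMod n), ∀ l, 1 ≤ l → l ≤ k →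
        ∀ j, 0 < L.x j → L.deltaW j < L.deltaR j → headway d l i ≤ L.hMax j from
      fun k i hk => h k i k hk le_rfl
    refine L.dynamics_induction hm_pos hm_lt (fun i l hl hl' => by omega) fun k hk i h1 h2 => ?_
    intro l
    induction l with
    | zero => intro hl; omega
    | succ l ih =>
      intro _ hlk j hxj hWj
      rcases Nat.eq_zero_or_pos l with rfl | hl
      · exact hH j hxj hWj i
      have hb := L.b_le_one i
      have hb' := L.bBar_le_one (i + 1)
      have e1 := h1 (l + 1 - L.b i) (by omega) (by omega) j hxj hWj
      have e2 := h2 (l + 1 - L.bBar (i + 1)) (by omega) (by omega) j hxj hWj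
      -- Comparing departures `l` and `l + 1` needs the exact nominal time at `l`, from the inner
      -- hypothesis, but only an upper bound at `l + 1`, so there is no circularity.
      have ht := travelTime_eq_nominalTime (hW i) (ih hl (by omega) i)
      have ht' := travelTime_le_nominalTime (hW i) (headway d (l + 1) i)
      have hl1 := hd l hl i
      rw [ht] at hl1
      have hm1 := (le_max_left _ _).trans_eq hl1.symm
      have hm2 := (le_max_right _ _).trans_eq hl1.symm
      rw [headway, show l + 1 - L.b i - 1 = l - L.b i by omega] at e1
      rw [headway, show l + 1 - L.bBar (i + 1) - 1 = l - L.bBar (i + 1) by omega] at e2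
      have hle : d (l + 1) i ≤ d l i + L.hMax j := by
        rw [hd (l + 1) (by omega) i]
        exact max_le (by linarith) (by linarith)
      rw [headway, Nat.add_sub_cancel]
      linarith
  intro k hk j
  have h := hd k hk j
  rwa [travelTime_eq_nominalTime (hW j) (key k j hk j), nominalTime] at h

end LinearLine

theorem mainTheorem7 (n : ℕ) [NeZero n] (L : LinearLine n)
    (hm_pos : 0 < L.trains) (hm_lt : L.trains < n) (hx : ∀ j, L.x j < 1) :
    (∀ d : ℕ → ZMod n → ℝ, L.IsMaxPlusTrajectory d →
      HasAverageGrowthRate d L.headwayFormula ∧ HasAverageHeadway d L.headwayFormula) ∧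
    (∀ d : ℕ → ZMod n → ℝ, L.IsDemandDependentTrajectory d →
      (∀ j, headway d 1 j ≤ L.hMax j) →
      (∀ j, L.deltaW j ≤ L.deltaR j) →
      (∀ j, 0 < L.x j → L.deltaW j < L.deltaR j → ∀ i, headway d 1 i ≤ L.hMax j) →
      HasAverageGrowthRate d L.headwayFormula ∧ HasAverageHeadway d L.headwayFormula) := by
  refine ⟨fun d hd => ?_, fun d hd _ hW hH => ?_⟩
  · have h := hd.hasAverageGrowthRate hm_pos hm_lt
    exact ⟨h, h.hasAverageHeadway⟩
  · have h := (hd.isMaxPlusTrajectory hm_pos hm_lt hW hH).hasAverageGrowthRate hm_pos hm_lt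
    exact ⟨h, h.hasAverageHeadway⟩
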